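/- Let $\mathbb{K}$ be a field of characteristic zero, let $V$ be a finite set, let $S=\mathbb{K}[x_v : v\in V]$, and let $\Delta$ be a pure simplicial complex on $V$ of dimension at least $1$ (not every element of $V$ has to be a vertex of $\Delta$). For $\tau\subseteq V$ put $x_\tau=\prod_{v\in\tau}x_v$. Let $\mathcal{F}(\Delta)=(x_F : F \text{ a facet of }\Delta)\subset S$ be the facet ideal of $\Delta$, let $\mathcal{N}(\Delta)=(x_\tau : \tau\subseteq V,\ \tau\notin\Delta)$ be its Stanley-Reisner ideal, and let $$A(\Delta)=\frac{S}{\mathcal{N}(\Delta)+(x_v^2 : v\in V)}.$$ For an ideal $I\subset S$ and $m\ge 1$, let $I^{(m)}=\bigcap_{P\in\mathrm{Ass}(S/I)}(I^mS_P\cap S)$ denote the $m$-th symbolic power of $I$; the ideal $I$ is called normally torsion-free if $I^{(m)}=I^m$ for all $m\ge 1$. A standard graded artinian algebra $A=\bigoplus_i A_i$ over $\mathbb{K}$ has the strong Lefschetz property (SLP) if, for a general linear form $L$, every multiplication map $\times L^j: A_i\to A_{i+j}$ ($i,j\ge 0$) has full rank. Theorem (SLP and symbolic powers are not compatible). Suppose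 that $\Delta$ has at least as many facets as vertices. If $\mathcal{F}(\Delta)$ is normally torsion-free, then $A(\Delta)$ fails the SLP. -/

import Mathlib

open MvPolynomial

noncomputable section

namespace StrongLefschetz

/-! Simplicial complexes on a finite vertex set `V` are Mathlib's `PreAbstractSimplicialComplex V`:
downward closed families of nonempty finsets, in which the empty face is left implicit.
Not every element of `V` is required to be a vertex of the complex. -/

section Complex

variable {V : Type*}

/-- A facet is a face that is maximal with respect to inclusion. -/
def IsFacet (Δ : PreAbstractSimplicialComplex V) (F : Finset V) : Prop :=
  Maximal (fun σ => σ ∈ Δ) F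

/-- The set of facets of `Δ`. -/
def facets (Δ : PreAbstractSimplicialComplex V) : Set (Finset V) := {F | IsFacet Δ F}

/-- The set of vertices of `Δ`, that is, of its `0`-dimensional faces. -/
def vertices (Δ : PreAbstractSimplicialComplex V) : Set V := {v | {v} ∈ Δ}

/-- `Δ` is pure: all its facets have the same dimension. -/
def IsPure (Δ : PreAbstractSimplicialComplex V) : Prop :=
  ∀ F G : Finset V, IsFacet Δ F → IsFacet Δ G → F.card = G.card

open Classical in
/-- The dimension of `Δ`: the maximum of `|τ| - 1` over the faces `τ`
(it is `-1` if the empty face is the only face). -/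
def dimension [Fintype V] (Δ : PreAbstractSimplicialComplex V) : ℤ :=
  ((Finset.univ.filter (fun σ : Finset V => σ ∈ Δ)).sup Finset.card : ℕ) - 1

variable (K : Type*) [Field K]

/-- The squarefree monomial `x_τ`, the product of the variables indexed by `τ`. -/
def faceMonomial (τ : Finset V) : MvPolynomial V K := ∏ v ∈ τ, X v

/-- The facet ideal, generated by the monomials `x_F` for the facets `F`. -/
def facetIdeal (Δ : PreAbstractSimplicialComplex V) : Ideal (MvPolynomial V K) :=
  Ideal.span (faceMonomial K '' facets Δ)

/-- The Stanley-Reisner ideal, generated by the monomials of the nonfaces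
(the empty set always counts as a face). -/
def stanleyReisnerIdeal (Δ : PreAbstractSimplicialComplex V) : Ideal (MvPolynomial V K) :=
  Ideal.span (faceMonomial K '' {τ | τ.Nonempty ∧ τ ∉ Δ})

/-- The defining ideal of the algebra `A(Δ)`: the Stanley-Reisner ideal plus the squares of all
the variables. -/
def artinianIdeal (Δ : PreAbstractSimplicialComplex V) : Ideal (MvPolynomial V K) :=
  stanleyReisnerIdeal K Δ ⊔ Ideal.span (Set.range fun v : V => (X v : MvPolynomial V K) ^ 2)

end Complex

section Symbolic

variable {R : Type*} [CommRing R]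

/-- The `m`-th symbolic power of `I`: the intersection over the associated primes `P` of `I`
(that is, of the module `R ⧸ I`) of the contractions to `R` of `I ^ m R_P`. -/
def symbolicPower (I : Ideal R) (m : ℕ) : Ideal R :=
  ⨅ (P : PrimeSpectrum R) (_ : P.asIdeal ∈ associatedPrimes R (R ⧸ I)),
    ((I ^ m).map (algebraMap R (Localization.AtPrime P.asIdeal))).comap
      (algebraMap R (Localization.AtPrime P.asIdeal))

/-- `I` is normally torsion-free: all its symbolic powers are ordinary powers. -/
def IsNormallyTorsionFree (I : Ideal R) : Prop :=
  ∀ m : ℕ, 1 ≤ m → symbolicPower I m = I ^ m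

end Symbolic

section Lefschetz

variable {V K : Type*} [Field K]

/-- The degree `i` component of `A = K[x_v : v ∈ V] ⧸ I`. -/
def gradedPart (I : Ideal (MvPolynomial V K)) (i : ℕ) : Submodule K (MvPolynomial V K ⧸ I) :=
  (homogeneousSubmodule V K i).map (Ideal.Quotient.mkₐ K I).toLinearMap

variable [Fintype V]

/-- The linear form with coefficients `c`. -/
def linearForm (c : V → K) : MvPolynomial V K := ∑ v, C (c v) * X v

theorem linearForm_pow_mul_mem (I : Ideal (MvPolynomial V K)) (c : V → K) (i j : ℕ) :
    ∀ a ∈ gradedPart I i,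
      LinearMap.mulLeft K (Ideal.Quotient.mk I (linearForm c) ^ j) a ∈ gradedPart I (i + j) := by
  rintro _ ⟨f, hf, rfl⟩
  refine ⟨linearForm c ^ j * f, ?_, by simp⟩
  have hL : (linearForm c).IsHomogeneous 1 :=
    IsHomogeneous.sum _ _ _ fun v _ => isHomogeneous_C_mul_X _ _
  have h := (hL.pow j).mul hf
  rw [one_mul, add_comm] at h
  exact h

/-- The multiplication map `× L ^ j : A_i → A_{i+j}` by the `j`-th power of the linear form `L`
with coefficients `c`. -/
def lefschetzMap (I : Ideal (MvPolynomial V K)) (c : V → K) (i j : ℕ) :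
    gradedPart I i →ₗ[K] gradedPart I (i + j) :=
  (LinearMap.mulLeft K (Ideal.Quotient.mk I (linearForm c) ^ j)).restrict
    (linearForm_pow_mul_mem I c i j)

/-- A linear map has full rank if its rank is the minimum of the dimensions of its source and
target (used for finite-dimensional spaces only). -/
def HasFullRank {M N : Type*} [AddCommGroup M] [Module K M] [AddCommGroup N] [Module K N]
    (f : M →ₗ[K] N) : Prop :=
  Module.finrank K (LinearMap.range f) = min (Module.finrank K M) (Module.finrank K N)

/-- The strong Lefschetz property of `K[x_v : v ∈ V] ⧸ I` (over an infinite field): for a general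
linear form `L`, every map `× L ^ j : A_i → A_{i+j}` has full rank. "General" means that the
coefficient vector `c` of `L` ranges over a nonempty Zariski open set, which may be taken to be the
locus where some nonzero polynomial `p` does not vanish. -/
def HasSLP (I : Ideal (MvPolynomial V K)) : Prop :=
  ∃ p : MvPolynomial V K, p ≠ 0 ∧
    ∀ c : V → K, eval c p ≠ 0 → ∀ i j : ℕ, HasFullRank (lefschetzMap I c i j)

end Lefschetz

end StrongLefschetz

end

open MvPolynomial

namespace StrongLefschetz

/-! ### Squarefree monomials and their exponent vectors -/

section Exponents

variable {V : Type*}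

/-! Both hypotheses are read off the facet-vertex incidence matrix. Let facets have `d + 1`
elements.

Under the SLP, some `L = ∑ c_v x_v` with all `c_v ≠ 0` has `× L^d : A_1 → A_{d+1}` of full rank.
This map is injective, as `dim A_1` is at most the number of vertices and `dim A_{d+1}` at least the
number of facets. The coefficient of `x_F` in `(∑ y_v c_v x_v) L^d` is `d! (∏_{v ∈ F} c_v) ∑_{v ∈ F}
y_v`, so the incidence matrix has trivial kernel (`HasSLP.incidence_injective`).

An associated prime `P` of the facet ideal `I` gives the vertex cover `C = {v : x_v ∈ P}`. If every
facet met `C` exactly once, `(d + 1) 1_C - 1` would be a nonzero kernel vector. Hence some facet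
meets `C` twice, and the product of all `t` facet monomials, even divided by one variable, lies in
`I^t` locally at every `P`. Its degree `t (d + 1) - 1` is too small for `I^t`
(`not_isNormallyTorsionFree_of_incidence_injective`). -/

/-- The exponent vector of the squarefree monomial `x_τ`. -/
noncomputable def squarefreeExponent (τ : Finset V) : V →₀ ℕ := ∑ v ∈ τ, Finsupp.single v 1

open Classical in
theorem squarefreeExponent_apply (τ : Finset V) (v : V) :
    squarefreeExponent τ v = if v ∈ τ then 1 else 0 := by
  simp [squarefreeExponent, Finsupp.finsetSum_apply, Finsupp.single_apply]

theorem support_squarefreeExponent (τ : Finset V) : (squarefreeExponent τ).support = τ := by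
  ext v
  simp [squarefreeExponent_apply]

theorem squarefreeExponent_injective :
    Function.Injective (squarefreeExponent : Finset V → V →₀ ℕ) := fun σ τ h => by
  rw [← support_squarefreeExponent σ, h, support_squarefreeExponent]

theorem degree_squarefreeExponent (τ : Finset V) : (squarefreeExponent τ).degree = τ.card := by
  simp [squarefreeExponent]

theorem squarefreeExponent_le_iff {τ : Finset V} {b : V →₀ ℕ} :
    squarefreeExponent τ ≤ b ↔ τ ⊆ b.support := by
  classical
  constructor
  · intro h v hv
    have := h v
    rw [squarefreeExponent_apply, if_pos hv] at this
    simp only [Finsupp.mem_support_iff]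
    omega
  · intro h v
    rw [squarefreeExponent_apply]
    split_ifs with hv
    · exact Nat.one_le_iff_ne_zero.mpr (Finsupp.mem_support_iff.mp (h hv))
    · exact Nat.zero_le _

theorem squarefreeExponent_sub_single [DecidableEq V] {τ : Finset V} {v : V} (hv : v ∈ τ) :
    squarefreeExponent τ - Finsupp.single v 1 = squarefreeExponent (τ.erase v) := by
  ext w
  by_cases hw : v = w
  · subst hw
    simp [squarefreeExponent_apply, hv]
  · simp [squarefreeExponent_apply, Ne.symm hw]

theorem eq_squarefreeExponent_support {b : V →₀ ℕ} (hb : ∀ v, b v < 2) :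
    b = squarefreeExponent b.support := by
  ext v
  have := hb v
  simp only [squarefreeExponent_apply, Finsupp.mem_support_iff]
  split_ifs <;> omega

variable (K : Type*) [Field K]

theorem faceMonomial_eq_monomial (τ : Finset V) :
    faceMonomial K τ = monomial (squarefreeExponent τ) 1 := by
  rw [faceMonomial, squarefreeExponent, monomial_sum_one]
  rfl

theorem faceMonomial_mem_pow_idealOfVars_iff (τ : Finset V) (n : ℕ) :
    faceMonomial K τ ∈ idealOfVars V K ^ n ↔ n ≤ τ.card := by
  rw [faceMonomial_eq_monomial, monomial_mem_pow_idealOfVars_iff _ _ one_ne_zero,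
    degree_squarefreeExponent]

variable {K}

theorem mem_span_faceMonomial_iff {s : Set (Finset V)} {f : MvPolynomial V K} :
    f ∈ Ideal.span (faceMonomial K '' s) ↔ ∀ b ∈ f.support, ∃ τ ∈ s, τ ⊆ b.support := by
  have : faceMonomial K '' s = (fun b => monomial b (1 : K)) '' (squarefreeExponent '' s) := by
    rw [Set.image_image]
    exact Set.image_congr fun τ _ => faceMonomial_eq_monomial K τ
  rw [this, mem_ideal_span_monomial_image]
  simp [squarefreeExponent_le_iff]

end Exponents

/-! ### Faces and facets of a pure complex -/

section Faces

variable {V : Type*} {Δ : PreAbstractSimplicialComplex V}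

theorem face_of_subset {σ τ : Finset V} (h : σ ∈ Δ) (hτ : τ ⊆ σ) (hne : τ.Nonempty) : τ ∈ Δ :=
  (Δ.isRelLowerSet_faces h).2 hτ hne

theorem mem_vertices_of_mem_face {σ : Finset V} (h : σ ∈ Δ) {v : V} (hv : v ∈ σ) :
    v ∈ vertices Δ :=
  face_of_subset h (by simpa using hv) (by simp)

/-- In a pure complex of dimension at least `1`, the facets are the faces of some fixed
cardinality `r ≥ 2`, and there is at least one. -/
theorem exists_isFacet_iff_card [Fintype V] (hpure : IsPure Δ) (hdim : 1 ≤ dimension Δ) :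
    ∃ r : ℕ, 1 ≤ r ∧ (∀ F, IsFacet Δ F ↔ F ∈ Δ ∧ F.card = r + 1) ∧ ∃ F, IsFacet Δ F := by
  classical
  set s := Finset.univ.filter (fun σ : Finset V => σ ∈ Δ) with hs
  have hsup : 2 ≤ s.sup Finset.card := by
    simp only [dimension] at hdim
    have : (2 : ℤ) ≤ ((s.sup Finset.card : ℕ) : ℤ) := by
      simp only [hs]
      convert (by linarith : (2 : ℤ) ≤ _) using 1
    exact_mod_cast this
  have hne : s.Nonempty := by
    rw [Finset.nonempty_iff_ne_empty]
    intro h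
    simp [h] at hsup
  obtain ⟨F₀, hF₀, hcard⟩ := Finset.exists_mem_eq_sup s hne Finset.card
  have hface : ∀ F : Finset V, F ∈ Δ → F.card = s.sup Finset.card → IsFacet Δ F := by
    refine fun F hF hc => ⟨hF, fun G hG hFG => ?_⟩
    have : G.card ≤ s.sup Finset.card := Finset.le_sup (f := Finset.card) (by simpa [hs] using hG)
    exact (Finset.eq_of_subset_of_card_le hFG (by omega)).ge
  have hF₀' : IsFacet Δ F₀ := hface F₀ (by simpa [hs] using hF₀) hcard.symm
  refine ⟨s.sup Finset.card - 1, by omega, fun F => ?_, F₀, hF₀'⟩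
  rw [Nat.sub_add_cancel (by omega)]
  exact ⟨fun hF => ⟨hF.1, by rw [hcard, hpure F F₀ hF hF₀']⟩, fun hF => hface F hF.1 hF.2⟩

end Faces

/-! ### Trivial incidence kernel obstructs normal torsion-freeness -/

section Symbolic

variable {V K : Type*} [Field K] {s : Set (Finset V)} {P : Ideal (MvPolynomial V K)}

/-- An associated prime `P` of a squarefree monomial ideal defines a minimal vertex cover: each
variable `x_u` of `P` is the only variable of `P` that divides a suitable generator. -/
theorem exists_mem_forall_X_notMem [Finite V]
    (hP : P ∈ associatedPrimes (MvPolynomial V K)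
      (MvPolynomial V K ⧸ Ideal.span (faceMonomial K '' s)))
    {u : V} (hu : X u ∈ P) : ∃ F ∈ s, u ∈ F ∧ ∀ w ∈ F, w ≠ u → X w ∉ P := by
  classical
  obtain ⟨hprime, x, hx⟩ := isAssociatedPrime_iff.mp (AssociatedPrimes.mem_iff.mp hP)
  obtain ⟨f, rfl⟩ := Ideal.Quotient.mk_surjective x
  have hmem : ∀ g, g ∈ P ↔ g * f ∈ Ideal.span (faceMonomial K '' s) := fun g => by
    rw [hx, Submodule.mem_colon_singleton, Submodule.mem_bot, ← Ideal.Quotient.eq_zero_iff_mem,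
      map_mul]
    rfl
  have hf : f ∉ Ideal.span (faceMonomial K '' s) := fun h =>
    hprime.ne_top ((Ideal.eq_top_iff_one P).mpr ((hmem 1).mpr (by simpa using h)))
  simp only [mem_span_faceMonomial_iff] at hf
  push Not at hf
  obtain ⟨b, hb, hbF⟩ := hf
  -- The monomial `x^b` of `f` lies outside the ideal, but `x_w f` lies in it, hence so does its
  -- monomial `x_w x^b`.
  have key : ∀ w, X w ∈ P → ∃ F ∈ s, F ⊆ insert w b.support := fun w hw => by
    have h := mem_span_faceMonomial_iff.mp ((hmem _).mp hw) (Finsupp.single w 1 + b) (by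
      rw [mem_support_iff, coeff_X_mul]
      exact mem_support_iff.mp hb)
    obtain ⟨F, hF, hFb⟩ := h
    refine ⟨F, hF, fun v hv => ?_⟩
    have := hFb hv
    by_cases hvw : v = w
    · simp [hvw]
    · simpa [hvw, Finsupp.single_apply, Ne.symm hvw] using this
  obtain ⟨F, hF, hFb⟩ := key u hu
  refine ⟨F, hF, ?_, fun w hw hwu hwP => ?_⟩
  · by_contra h
    exact hbF F hF ((Finset.subset_insert_iff_of_notMem h).mp hFb)
  · obtain ⟨G, hG, hGb⟩ := key w hwP
    have hwb : w ∈ b.support := (Finset.mem_insert.mp (hFb hw)).resolve_left hwu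
    rw [Finset.insert_eq_of_mem hwb] at hGb
    exact hbF G hG hGb

/-- Some generator contains `x_u` as its only variable in `P`; its other variables become units in
the localization. -/
theorem algebraMap_X_mem_map [Finite V] [P.IsPrime]
    (hP : P ∈ associatedPrimes (MvPolynomial V K)
      (MvPolynomial V K ⧸ Ideal.span (faceMonomial K '' s)))
    {u : V} (hu : X u ∈ P) :
    algebraMap (MvPolynomial V K) (Localization.AtPrime P) (X u) ∈
      (Ideal.span (faceMonomial K '' s)).map (algebraMap _ (Localization.AtPrime P)) := by
  classical
  obtain ⟨F, hF, huF, hw⟩ := exists_mem_forall_X_notMem hP hu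
  have hunit : IsUnit (algebraMap (MvPolynomial V K) (Localization.AtPrime P)
      (∏ w ∈ F.erase u, X w)) := by
    refine (IsLocalization.AtPrime.isUnit_to_map_iff _ P _).mpr fun h => ?_
    obtain ⟨w, hwF, hwP⟩ := (Ideal.IsPrime.prod_mem_iff (p := P)).mp h
    exact hw w (Finset.mem_of_mem_erase hwF) (Finset.ne_of_mem_erase hwF) hwP
  rw [← Ideal.mul_unit_mem_iff_mem _ hunit, ← map_mul, Finset.mul_prod_erase F _ huF]
  exact Ideal.mem_map_of_mem _ (Ideal.subset_span ⟨F, hF, rfl⟩)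

open Classical in
theorem algebraMap_faceMonomial_mem_map_pow [Finite V] [P.IsPrime]
    (hP : P ∈ associatedPrimes (MvPolynomial V K)
      (MvPolynomial V K ⧸ Ideal.span (faceMonomial K '' s))) (τ : Finset V) :
    algebraMap (MvPolynomial V K) (Localization.AtPrime P) (faceMonomial K τ) ∈
      (Ideal.span (faceMonomial K '' s)).map (algebraMap _ (Localization.AtPrime P)) ^
        (τ.filter fun v => X v ∈ P).card := by
  rw [faceMonomial, ← Finset.prod_filter_mul_prod_filter_not τ (fun v => X v ∈ P), map_mul,
    map_prod]
  refine Ideal.mul_mem_right _ _ ?_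
  rw [← Finset.prod_const]
  exact Ideal.prod_mem_prod fun v hv => algebraMap_X_mem_map hP (Finset.mem_filter.mp hv).2

/-- If the incidence vectors of the members of `s`, all of cardinality `r ≥ 2`, separate the
functions supported on the union of `s`, then the facet ideal is not normally torsion-free. -/
theorem not_isNormallyTorsionFree_of_incidence_injective [Fintype V] [CharZero K] {r : ℕ}
    (hr : 1 ≤ r) (hne : s.Nonempty) (hcard : ∀ F ∈ s, F.card = r + 1)
    (hinj : ∀ y : V → K, (∀ F ∈ s, ∑ v ∈ F, y v = 0) → ∀ F ∈ s, ∀ v ∈ F, y v = 0) :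
    ¬ IsNormallyTorsionFree (Ideal.span (faceMonomial K '' s)) := by
  classical
  intro hntf
  set I := Ideal.span (faceMonomial K '' s) with hI
  obtain ⟨F₀, hF₀⟩ := hne
  obtain ⟨v₀, hv₀⟩ : F₀.Nonempty := Finset.card_pos.mp (by rw [hcard F₀ hF₀]; omega)
  set t : Finset (Finset V) := s.toFinite.toFinset with ht
  have hmt : ∀ F, F ∈ t ↔ F ∈ s := fun F => by simp [ht]
  have hF₀t := (hmt F₀).mpr hF₀
  -- The product of all generators divided by `x_{v₀}`: the witness in the symbolic power but not in
  -- the ordinary one.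
  set g : MvPolynomial V K := faceMonomial K (F₀.erase v₀) * ∏ F ∈ t.erase F₀, faceMonomial K F
    with hg
  have hXg : X v₀ * g = monomial (∑ F ∈ t, squarefreeExponent F) 1 := by
    rw [hg, ← mul_assoc, faceMonomial, Finset.mul_prod_erase F₀ _ hv₀,
      show ∏ v ∈ F₀, (X v : MvPolynomial V K) = faceMonomial K F₀ from rfl,
      Finset.mul_prod_erase t _ hF₀t, monomial_sum_one]
    exact Finset.prod_congr rfl fun F _ => faceMonomial_eq_monomial K F
  have hle : I ≤ idealOfVars V K ^ (r + 1) := by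
    rw [hI, Ideal.span_le]
    rintro _ ⟨F, hF, rfl⟩
    exact (faceMonomial_mem_pow_idealOfVars_iff K F _).mpr (hcard F hF).ge
  have hnot : g ∉ I ^ t.card := by
    intro h
    have h1 : g ∈ idealOfVars V K ^ ((r + 1) * t.card) := by
      rw [pow_mul]
      exact Ideal.pow_right_mono hle _ h
    have h2 : X v₀ * g ∈ idealOfVars V K ^ ((r + 1) * t.card + 1) := by
      rw [pow_succ']
      exact Ideal.mul_mem_mul (Ideal.subset_span ⟨v₀, rfl⟩) h1
    rw [hXg, monomial_mem_pow_idealOfVars_iff _ _ one_ne_zero, map_sum] at h2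
    simp only [degree_squarefreeExponent] at h2
    rw [Finset.sum_congr rfl fun F hF => hcard F ((hmt F).mp hF), Finset.sum_const,
      smul_eq_mul, mul_comm] at h2
    omega
  refine hnot ?_
  rw [← hntf t.card (Finset.card_pos.mpr ⟨F₀, hF₀t⟩)]
  simp only [symbolicPower, Ideal.mem_iInf]
  intro P hP
  rw [Ideal.mem_comap, Ideal.map_pow]
  set p := P.asIdeal
  let c : Finset V → ℕ := fun F => (F.filter fun v => (X v : MvPolynomial V K) ∈ p).card
  have hIp : I ≤ p := by
    obtain ⟨-, x, hx⟩ := isAssociatedPrime_iff.mp (AssociatedPrimes.mem_iff.mp hP)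
    obtain ⟨f, rfl⟩ := Ideal.Quotient.mk_surjective x
    intro h hh
    rw [hx, Submodule.mem_colon_singleton, Submodule.mem_bot]
    change Ideal.Quotient.mk I (h * f) = 0
    exact Ideal.Quotient.eq_zero_iff_mem.mpr (I.mul_mem_right _ hh)
  have hc : ∀ F ∈ t, 1 ≤ c F := fun F hF => by
    have : faceMonomial K F ∈ p := hIp (Ideal.subset_span ⟨F, (hmt F).mp hF, rfl⟩)
    obtain ⟨v, hv, hvp⟩ := (Ideal.IsPrime.prod_mem_iff (p := p)).mp this
    exact Finset.card_pos.mpr ⟨v, Finset.mem_filter.mpr ⟨hv, hvp⟩⟩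
  have hc2 : ∃ F ∈ t, 1 < c F := by
    by_contra! hall
    have h1 : ∀ F ∈ s, c F = 1 := fun F hF =>
      le_antisymm (hall F ((hmt F).mpr hF)) (hc F ((hmt F).mpr hF))
    -- Its sum over each `F` is `(r + 1) - (r + 1) = 0`, while its values are `r` and `-1`, both
    -- nonzero as `r ≥ 1` and the characteristic is zero.
    have h := hinj (fun v => (if (X v : MvPolynomial V K) ∈ p then ((r + 1 : ℕ) : K) else 0) - 1)
      (fun F hF => by
        rw [Finset.sum_sub_distrib, ← Finset.sum_filter, Finset.sum_const,
          show (F.filter fun v => (X v : MvPolynomial V K) ∈ p).card = 1 from h1 F hF]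
        simp [hcard F hF]) F₀ hF₀ v₀ hv₀
    by_cases hv : (X v₀ : MvPolynomial V K) ∈ p
    · simp only [if_pos hv, Nat.cast_add, Nat.cast_one, add_sub_cancel_right,
        Nat.cast_eq_zero] at h
      omega
    · simp [if_neg hv] at h
  have hsum : t.card < ∑ F ∈ t, c F := by
    rw [Finset.card_eq_sum_ones]
    exact Finset.sum_lt_sum hc hc2
  -- Dividing by `x_{v₀}` costs at most one order of vanishing, which the strict inequality absorbs.
  have herase : c F₀ ≤ c (F₀.erase v₀) + 1 := by
    simp only [c]
    rw [Finset.filter_erase]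
    have := Finset.pred_card_le_card_erase
      (s := F₀.filter fun v => (X v : MvPolynomial V K) ∈ p) (a := v₀)
    omega
  have hexp : t.card ≤ c (F₀.erase v₀) + ∑ F ∈ t.erase F₀, c F := by
    have := Finset.add_sum_erase t c hF₀t
    omega
  refine Ideal.pow_le_pow_right hexp ?_
  rw [hg, map_mul, map_prod, pow_add, ← Finset.prod_pow_eq_pow_sum]
  exact Ideal.mul_mem_mul (algebraMap_faceMonomial_mem_map_pow hP _)
    (Ideal.prod_mem_prod fun F _ => algebraMap_faceMonomial_mem_map_pow hP F)

end Symbolic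

/-! ### The Lefschetz map from degree one to the facet degree -/

section Lefschetz

variable {V K : Type*} [Field K] {Δ : PreAbstractSimplicialComplex V}

/-- Membership in the defining ideal of `A(Δ)` is tested on the coefficients of the squarefree
monomials that are supported on faces. -/
theorem mem_artinianIdeal_iff {f : MvPolynomial V K} :
    f ∈ artinianIdeal K Δ ↔
      ∀ τ : Finset V, (τ.Nonempty → τ ∈ Δ) → coeff (squarefreeExponent τ) f = 0 := by
  classical
  have hspan : artinianIdeal K Δ = Ideal.span ((fun b => monomial b (1 : K)) ''
      (squarefreeExponent '' {τ | τ.Nonempty ∧ τ ∉ Δ} ∪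
        Set.range fun v : V => Finsupp.single v 2)) := by
    rw [artinianIdeal, stanleyReisnerIdeal, ← Ideal.span_union, Set.image_union, Set.image_image,
      ← Set.range_comp]
    congr 2
    · exact Set.image_congr fun τ _ => faceMonomial_eq_monomial K τ
    · exact congrArg Set.range (funext fun v => X_pow_eq_monomial)
  rw [hspan, mem_ideal_span_monomial_image]
  constructor
  · intro h τ hτ
    by_contra hc
    obtain ⟨c, hc | ⟨v, rfl⟩, hle⟩ := h _ (mem_support_iff.mpr hc)
    · obtain ⟨σ, ⟨hσ, hσΔ⟩, rfl⟩ := hc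
      rw [squarefreeExponent_le_iff, support_squarefreeExponent] at hle
      exact hσΔ (face_of_subset (hτ (hσ.mono hle)) hle hσ)
    · have := hle v
      simp only [Finsupp.single_eq_same, squarefreeExponent_apply] at this
      split_ifs at this <;> omega
  · intro h b hb
    by_cases hsq : ∀ v, b v < 2
    · by_cases hface : b.support.Nonempty → b.support ∈ Δ
      · refine absurd (h _ hface) ?_
        rw [← eq_squarefreeExponent_support hsq]
        exact mem_support_iff.mp hb
      · push Not at hface
        exact ⟨_, Or.inl ⟨_, hface, rfl⟩, squarefreeExponent_le_iff.mpr subset_rfl⟩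
    · push Not at hsq
      obtain ⟨v, hv⟩ := hsq
      exact ⟨_, Or.inr ⟨v, rfl⟩, Finsupp.single_le_iff.mpr hv⟩

theorem mem_gradedPart (I : Ideal (MvPolynomial V K)) {f : MvPolynomial V K} {i : ℕ}
    (hf : f.IsHomogeneous i) : Ideal.Quotient.mk I f ∈ gradedPart I i :=
  ⟨f, hf, rfl⟩

theorem finite_gradedPart [Finite V] (I : Ideal (MvPolynomial V K)) (i : ℕ) :
    Module.Finite K (gradedPart I i) :=
  Module.Finite.iff_fg.mpr ((homogeneousSubmodule_fg V K i).map _)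

theorem finrank_gradedPart_one_le [Finite V] :
    Module.finrank K (gradedPart (artinianIdeal K Δ) 1) ≤ (vertices Δ).ncard := by
  classical
  set T : Finset V := (vertices Δ).toFinite.toFinset with hT
  have hle : gradedPart (artinianIdeal K Δ) 1 ≤ Submodule.span K
      ((T.image fun v => Ideal.Quotient.mk (artinianIdeal K Δ) (X v) :
        Finset (MvPolynomial V K ⧸ artinianIdeal K Δ)) : Set _) := by
    rw [gradedPart, homogeneousSubmodule_one_eq_span_X, Submodule.map_span_le]
    rintro _ ⟨v, rfl⟩
    change Ideal.Quotient.mk (artinianIdeal K Δ) (X v) ∈ _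
    by_cases hv : v ∈ vertices Δ
    · exact Submodule.subset_span (Finset.mem_coe.mpr
        (Finset.mem_image_of_mem _ (by simpa [hT] using hv)))
    · have : (X v : MvPolynomial V K) ∈ artinianIdeal K Δ :=
        (le_sup_left : stanleyReisnerIdeal K Δ ≤ _)
          (Ideal.subset_span ⟨{v}, ⟨by simp, hv⟩, by simp [faceMonomial]⟩)
      rw [Ideal.Quotient.eq_zero_iff_mem.mpr this]
      exact zero_mem _
  refine (Submodule.finrank_mono hle).trans ((finrank_span_finset_le_card _).trans ?_)
  refine Finset.card_image_le.trans ?_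
  rw [hT, Set.ncard_eq_toFinset_card _ (vertices Δ).toFinite]

theorem ncard_facets_le_finrank_gradedPart [Finite V] {i : ℕ}
    (hcard : ∀ F, IsFacet Δ F → F.card = i) :
    (facets Δ).ncard ≤ Module.finrank K (gradedPart (artinianIdeal K Δ) i) := by
  classical
  have := Fintype.ofFinite (facets Δ)
  have := finite_gradedPart (artinianIdeal K Δ) i
  have hhom : ∀ F : facets Δ, (faceMonomial K F.1).IsHomogeneous i := fun F => by
    rw [faceMonomial_eq_monomial]
    exact isHomogeneous_monomial _ (by rw [degree_squarefreeExponent, hcard F.1 F.2])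
  have hli : LinearIndependent K fun F : facets Δ =>
      (⟨_, mem_gradedPart _ (hhom F)⟩ : gradedPart (artinianIdeal K Δ) i) := by
    rw [Fintype.linearIndependent_iff]
    intro a ha F
    have h0 : Ideal.Quotient.mk (artinianIdeal K Δ)
        (∑ G : facets Δ, C (a G) * faceMonomial K G.1) = 0 := by
      rw [← Submodule.coe_eq_zero, Submodule.coe_sum] at ha
      rw [map_sum, ← ha]
      refine Finset.sum_congr rfl fun G _ => ?_
      rw [map_mul, Submodule.coe_smul]
      exact (Algebra.smul_def (a G) (Ideal.Quotient.mk _ (faceMonomial K G.1))).symm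
    have h1 := mem_artinianIdeal_iff.mp (Ideal.Quotient.eq_zero_iff_mem.mp h0) F.1
      fun _ => F.2.1
    simpa [coeff_sum, coeff_C_mul, faceMonomial_eq_monomial, coeff_monomial,
      squarefreeExponent_injective.eq_iff, Subtype.coe_inj] using h1
  rw [Set.ncard_eq_toFinset_card', Set.toFinset_card]
  exact hli.fintype_card_le_finrank

variable [Fintype V]

theorem isHomogeneous_linearForm (c : V → K) : (linearForm c).IsHomogeneous 1 :=
  IsHomogeneous.sum _ _ _ fun _ _ => isHomogeneous_C_mul_X _ _

theorem coeff_linearForm_mul [DecidableEq V] (c : V → K) (g : MvPolynomial V K) (τ : Finset V) :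
    coeff (squarefreeExponent τ) (linearForm c * g) =
      ∑ v ∈ τ, c v * coeff (squarefreeExponent (τ.erase v)) g := by
  rw [linearForm, Finset.sum_mul, coeff_sum, ← Finset.sum_subset (Finset.subset_univ τ)]
  · refine Finset.sum_congr rfl fun v hv => ?_
    rw [mul_assoc, coeff_C_mul, coeff_X_mul', support_squarefreeExponent, if_pos hv,
      squarefreeExponent_sub_single hv]
  · intro v _ hv
    rw [mul_assoc, coeff_C_mul, coeff_X_mul', support_squarefreeExponent, if_neg hv, mul_zero]

theorem coeff_linearForm_pow (c : V → K) (k : ℕ) :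
    ∀ τ : Finset V, τ.card = k →
      coeff (squarefreeExponent τ) (linearForm c ^ k) = k.factorial * ∏ v ∈ τ, c v := by
  classical
  induction k with
  | zero =>
    intro τ hτ
    obtain rfl := Finset.card_eq_zero.mp hτ
    simp [squarefreeExponent]
  | succ k ih =>
    intro τ hτ
    have h : ∀ v ∈ τ, c v * coeff (squarefreeExponent (τ.erase v)) (linearForm c ^ k) =
        k.factorial * ∏ w ∈ τ, c w := fun v hv => by
      rw [ih _ (by rw [Finset.card_erase_of_mem hv, hτ]; rfl), ← Finset.mul_prod_erase τ c hv]
      ring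
    rw [pow_succ', coeff_linearForm_mul, Finset.sum_congr rfl h, Finset.sum_const, hτ,
      Nat.factorial_succ, nsmul_eq_mul]
    push_cast
    ring

/-- Twisting `y` by `c` completes each `∏_{w ∈ τ \ v} c_w` to the full product, which then factors
out and leaves an incidence sum. -/
theorem coeff_linearForm_mul_linearForm_pow (c y : V → K) {k : ℕ} {τ : Finset V}
    (hτ : τ.card = k + 1) :
    coeff (squarefreeExponent τ) (linearForm (fun v => y v * c v) * linearForm c ^ k) =
      k.factorial * (∏ v ∈ τ, c v) * ∑ v ∈ τ, y v := by
  classical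
  rw [coeff_linearForm_mul, Finset.mul_sum]
  refine Finset.sum_congr rfl fun v hv => ?_
  rw [coeff_linearForm_pow c k _ (by rw [Finset.card_erase_of_mem hv, hτ]; rfl),
    ← Finset.mul_prod_erase τ c hv]
  ring

theorem HasFullRank.injective {M N : Type*} [AddCommGroup M] [Module K M] [Module.Finite K M]
    [AddCommGroup N] [Module K N] {f : M →ₗ[K] N} (hf : HasFullRank f)
    (h : Module.finrank K M ≤ Module.finrank K N) : Function.Injective f := by
  rw [HasFullRank, min_eq_left h] at hf
  have := f.finrank_range_add_finrank_ker
  exact LinearMap.ker_eq_bot.mp (Submodule.finrank_eq_zero.mp (by omega))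

/-- The strong Lefschetz property provides a linear form with nonzero coefficients
for which all the multiplication maps have full rank. -/
theorem HasSLP.exists_ne_zero [CharZero K] {I : Ideal (MvPolynomial V K)} (h : HasSLP I) :
    ∃ c : V → K, (∀ v, c v ≠ 0) ∧ ∀ i j, HasFullRank (lefschetzMap I c i j) := by
  obtain ⟨p, hp, hI⟩ := h
  -- The extra factor forces every coefficient of the chosen form to be nonzero.
  have hne : p * ∏ v, X v ≠ 0 :=
    mul_ne_zero hp (Finset.prod_ne_zero_iff.mpr fun v _ => X_ne_zero v)
  obtain ⟨c, hc⟩ : ∃ c : V → K, eval c (p * ∏ v, X v) ≠ 0 := by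
    by_contra! hall
    exact hne (MvPolynomial.funext fun c => by rw [hall c, map_zero])
  rw [map_mul, map_prod] at hc
  refine ⟨c, fun v => ?_, hI c (left_ne_zero_of_mul hc)⟩
  simpa using Finset.prod_ne_zero_iff.mp (right_ne_zero_of_mul hc) v (Finset.mem_univ v)

/-- If `A(Δ)` has the strong Lefschetz property and `Δ`, pure of dimension `d`, has at least as
many facets as vertices, then the incidence matrix of facets and vertices has trivial kernel. -/
theorem HasSLP.incidence_injective [CharZero K] {d : ℕ}
    (hfacet : ∀ F, IsFacet Δ F ↔ F ∈ Δ ∧ F.card = d + 1)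
    (hcard : (vertices Δ).ncard ≤ (facets Δ).ncard) (hslp : HasSLP (artinianIdeal K Δ))
    (y : V → K) (hy : ∀ F ∈ facets Δ, ∑ v ∈ F, y v = 0) :
    ∀ F ∈ facets Δ, ∀ v ∈ F, y v = 0 := by
  classical
  obtain ⟨c, hc, hrank⟩ := hslp.exists_ne_zero
  have := finite_gradedPart (artinianIdeal K Δ) 1
  have hinj := (hrank 1 d).injective (finrank_gradedPart_one_le.trans (hcard.trans
    (ncard_facets_le_finrank_gradedPart fun F hF => by rw [((hfacet F).mp hF).2, add_comm])))
  set l := linearForm fun v => y v * c v with hl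
  have hlhom : l.IsHomogeneous 1 := isHomogeneous_linearForm _
  have hprod : l * linearForm c ^ d ∈ artinianIdeal K Δ := by
    rw [mem_artinianIdeal_iff]
    intro τ hτ
    by_cases hτd : τ.card = d + 1
    · have hF : IsFacet Δ τ := (hfacet τ).mpr ⟨hτ (Finset.card_pos.mp (by omega)), hτd⟩
      rw [hl, coeff_linearForm_mul_linearForm_pow c y hτd, hy τ hF, mul_zero]
    · have hhom : (l * linearForm c ^ d).IsHomogeneous (1 + 1 * d) :=
        hlhom.mul ((isHomogeneous_linearForm c).pow d)
      exact hhom.coeff_eq_zero (by rw [degree_squarefreeExponent]; omega)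
  have hzero : (⟨_, mem_gradedPart (artinianIdeal K Δ) hlhom⟩ :
      gradedPart (artinianIdeal K Δ) 1) = 0 := by
    refine hinj ?_
    rw [map_zero]
    refine Subtype.ext ?_
    change Ideal.Quotient.mk _ (linearForm c) ^ d * Ideal.Quotient.mk _ l = 0
    rw [← map_pow, ← map_mul, mul_comm]
    exact Ideal.Quotient.eq_zero_iff_mem.mpr hprod
  have hlmem : l ∈ artinianIdeal K Δ :=
    Ideal.Quotient.eq_zero_iff_mem.mp (congrArg Subtype.val hzero)
  intro F hF v hv
  have h := mem_artinianIdeal_iff.mp hlmem {v} fun _ => mem_vertices_of_mem_face hF.1 hv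
  rw [← mul_one l, hl, coeff_linearForm_mul] at h
  simpa [squarefreeExponent, hc v] using h

end Lefschetz

end StrongLefschetz

theorem mainTheorem3 {V : Type*} [Fintype V] {K : Type*} [Field K] [CharZero K]
    (Δ : PreAbstractSimplicialComplex V)
    (hpure : StrongLefschetz.IsPure Δ)
    (hdim : 1 ≤ StrongLefschetz.dimension Δ)
    (hcard : (StrongLefschetz.vertices Δ).ncard ≤ (StrongLefschetz.facets Δ).ncard)
    (hntf : StrongLefschetz.IsNormallyTorsionFree (StrongLefschetz.facetIdeal K Δ)) :
    ¬ StrongLefschetz.HasSLP (StrongLefschetz.artinianIdeal K Δ) := by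
  intro hslp
  obtain ⟨d, hd, hfacet, hne⟩ := StrongLefschetz.exists_isFacet_iff_card hpure hdim
  exact StrongLefschetz.not_isNormallyTorsionFree_of_incidence_injective hd hne
    (fun F hF => ((hfacet F).mp hF).2) (hslp.incidence_injective hfacet hcard) hntf
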